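/- Let $A$ and $B$ be (complex, not necessarily unital) $C^*$-algebras and let $\varphi\colon A\to B$ be a bounded, linear map. We say that $\varphi$ preserves - zero-products if $ab=0$ implies $\varphi(a)\varphi(b)=0$ for all $a,b\in A$; - range-orthogonality if $a^*b=0$ implies $\varphi(a)^*\varphi(b)=0$ for all $a,b\in A$; - domain-orthogonality if $ab^*=0$ implies $\varphi(a)\varphi(b)^*=0$ for all $a,b\in A$; - zero-TRO-products if $ab^*c=0$ implies $\varphi(a)\varphi(b)^*\varphi(c)=0$ for all $a,b,c\in A$. Then: 1. $\varphi$ preserves zero-products if and only if $\varphi(ab)\varphi(c)=\varphi(a)\varphi(bc)$ for all $a,b,c\in A$. 2. $\varphi$ preserves range-orthogonality if and only if $\varphi(b^*a)^*\varphi(c)=\varphi(a)^*\varphi(bc)$ for all $a,b,c\in A$. 3. $\varphi$ preserves domain-orthogonality if and only if $\varphi(ab)\varphi(c)^*=\varphi(a)\varphi(cb^*)^*$ for all $a,b,c\in A$. 4. $\varphi$ preserves zero-TRO-products if and only if $\varphi(ab)\varphi(c)^*\varphi(de)=\varphi(a)\varphi(d^*cb^*)^*\varphi(e)$ for all $a,b,c,d,e\in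 A$. -/

import Mathlib

/-- A map between C*-algebras preserves zero-products: `ab = 0` implies `φ(a)φ(b) = 0`. -/
def PreservesZeroProducts {A B : Type*} [NonUnitalCStarAlgebra A] [NonUnitalCStarAlgebra B]
    (φ : A → B) : Prop :=
  ∀ a b : A, a * b = 0 → φ a * φ b = 0

/-- A map between C*-algebras preserves range-orthogonality:
`a*b = 0` implies `φ(a)*φ(b) = 0`, the star being the adjoint. -/
def PreservesRangeOrthogonality {A B : Type*} [NonUnitalCStarAlgebra A] [NonUnitalCStarAlgebra B]
    (φ : A → B) : Prop :=
  ∀ a b : A, star a * b = 0 → star (φ a) * φ b = 0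

/-- A map between C*-algebras preserves domain-orthogonality:
`ab* = 0` implies `φ(a)φ(b)* = 0`. -/
def PreservesDomainOrthogonality {A B : Type*} [NonUnitalCStarAlgebra A] [NonUnitalCStarAlgebra B]
    (φ : A → B) : Prop :=
  ∀ a b : A, a * star b = 0 → φ a * star (φ b) = 0

/-- A map between C*-algebras preserves zero-TRO-products:
`ab*c = 0` implies `φ(a)φ(b)*φ(c) = 0`. -/
def PreservesZeroTROProducts {A B : Type*} [NonUnitalCStarAlgebra A] [NonUnitalCStarAlgebra B]
    (φ : A → B) : Prop :=
  ∀ a b c : A, a * star b * c = 0 → φ a * star (φ b) * φ c = 0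

/-! All four equivalences say that a bounded map vanishing on zero products is balanced: `V (a * b)
c = V a (b * c)`. By linearity take `b = h` self-adjoint and pull back along the functional
calculus: `W f g = V (a * f(h)) (g(h) * c)` vanishes whenever `f * g = 0`, and the claim becomes `W
t 1 = W 1 t` for the coordinate function `t`. For real `t ≥ 0` the defect `‖W t 1 - W 1 t‖` is at
most `8 * M`, however large `t` is; replacing `t` by `n • t` forces it to vanish. The bound comes
from rounding `t`, on each of two pieces of a partition of unity, to a continuous function that is
integer-valued there, for which the identity is exact. Conversely, an approximate unit recovers the
zero-product condition. Adjoints are absorbed by `starConj`. -/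

open Filter Topology

section BilinearContinuousFunctions

variable {K X : Type*} [TopologicalSpace K] [NormedAddCommGroup X]
  [NormedSpace ℝ X]

/-- `x` clamped to the unit interval. -/
def unitClamp (x : ℝ) : ℝ := max 0 (min 1 x)

lemma continuous_unitClamp : Continuous unitClamp := by
  unfold unitClamp; fun_prop

lemma sum_unitClamp_sub (x : ℝ) (hx : 0 ≤ x) (N : ℕ) :
    ∑ i ∈ Finset.range N, unitClamp (x - i) = min x N := by
  induction N with
  | zero => simp [hx]
  | succ n ih =>
    rw [Finset.sum_range_succ, ih, unitClamp]
    push_cast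
    grind

lemma unitClamp_intCast_sub_natCast (n : ℤ) (i : ℕ) :
    unitClamp ((n : ℝ) - i) = 0 ∨ unitClamp ((n : ℝ) - i) = 1 := by
  unfold unitClamp
  rcases le_or_gt n i with h | h
  · left
    have : (n : ℝ) ≤ i := by exact_mod_cast h
    grind
  · right
    have : (i : ℝ) + 1 ≤ n := by exact_mod_cast h
    grind

/-- A continuous version of the floor function: it takes integer values at `x` unless the
fractional part of `x` is smaller than `1/3`. -/
noncomputable def ramp (x : ℝ) : ℝ := x + (min 1 (3 * Int.fract x) - Int.fract x)

lemma continuous_ramp : Continuous ramp := by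
  have h : Continuous ((fun y : ℝ ↦ min 1 (3 * y) - y) ∘ Int.fract) :=
    ContinuousOn.comp_fract'' (by fun_prop) (by norm_num)
  exact continuous_id.add h

lemma abs_ramp_sub_le (x : ℝ) : |ramp x - x| ≤ 1 := by
  have h0 := Int.fract_nonneg x
  have h1 := Int.fract_lt_one x
  unfold ramp
  grind

lemma ramp_nonneg {x : ℝ} (hx : 0 ≤ x) : 0 ≤ ramp x := by
  have h0 := Int.fract_nonneg x
  have h1 := Int.fract_lt_one x
  unfold ramp
  grind

lemma exists_ramp_eq_intCast {x : ℝ} (hx : 1 / 3 ≤ Int.fract x) : ∃ n : ℤ, ramp x = n := by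
  refine ⟨⌊x⌋ + 1, ?_⟩
  have h := Int.floor_add_fract x
  unfold ramp
  push_cast
  grind

/-- A periodic bump, vanishing where the fractional part is at most `1/3` and equal to `1` where
it lies in `[1/2, 5/6]`. -/
noncomputable def bump (x : ℝ) : ℝ :=
  unitClamp (min (6 * Int.fract x - 2) (6 - 6 * Int.fract x))

lemma continuous_bump : Continuous bump := by
  have h : Continuous
      ((fun y : ℝ ↦ unitClamp (min (6 * y - 2) (6 - 6 * y))) ∘ Int.fract) := by
    refine ContinuousOn.comp_fract'' ?_ ?_
    · exact (continuous_unitClamp.comp (by fun_prop)).continuousOn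
    · norm_num [unitClamp]
  exact h

lemma abs_bump_le (x : ℝ) : |bump x| ≤ 1 := by
  unfold bump unitClamp; grind

lemma abs_one_sub_bump_le (x : ℝ) : |1 - bump x| ≤ 1 := by
  unfold bump unitClamp; grind

lemma bump_eq_zero_or_exists_ramp_eq (x : ℝ) : bump x = 0 ∨ ∃ n : ℤ, ramp x = n := by
  rcases le_total (1 / 3) (Int.fract x) with h | h
  · exact .inr (exists_ramp_eq_intCast h)
  · left
    unfold bump unitClamp
    grind

/-- The half-shift moves the bad fractional parts `[0, 1/3)` to `[1/2, 5/6)`, where `bump` is `1`.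
-/
lemma one_sub_bump_eq_zero_or_exists_ramp_eq (x : ℝ) :
    1 - bump x = 0 ∨ ∃ n : ℤ, ramp (x + 1 / 2) = n := by
  by_cases h : 1 / 3 ≤ Int.fract (x + 1 / 2)
  · exact .inr (exists_ramp_eq_intCast h)
  · left
    have h0 := Int.fract_nonneg x
    have h1 := Int.fract_lt_one x
    have hx : 1 / 2 ≤ Int.fract x ∧ Int.fract x ≤ 5 / 6 := by
      push Not at h
      rcases lt_or_ge (Int.fract x) (1 / 2) with h2 | h2
      · have : Int.fract (x + 1 / 2) = Int.fract x + 1 / 2 := by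
          rw [Int.fract_eq_iff]
          exact ⟨by linarith, by linarith, ⌊x⌋, by linarith [Int.floor_add_fract x]⟩
        linarith
      · have : Int.fract (x + 1 / 2) = Int.fract x - 1 / 2 := by
          rw [Int.fract_eq_iff]
          exact ⟨by linarith, by linarith, ⌊x⌋ + 1, by
            push_cast; linarith [Int.floor_add_fract x]⟩
        constructor <;> linarith
    unfold bump unitClamp
    grind

variable (W : C(K, ℝ) →ₗ[ℝ] C(K, ℝ) →ₗ[ℝ] X)

/-- Both sides equal `W (p * E) p`: on the support of `E`, `p` acts as an idempotent. -/
lemma apply_mul_one_eq_of_mul_mul_one_sub_eq_zero (hW : ∀ f g, f * g = 0 → W f g = 0)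
    {E p : C(K, ℝ)} (h : E * p * (1 - p) = 0) : W (p * E) 1 = W E p := by
  have h1 := hW (p * E) (1 - p) (by rw [← h]; ring)
  have h2 := hW ((1 - p) * E) p (by rw [← h]; ring)
  rw [map_sub, sub_eq_zero] at h1
  rw [sub_mul, one_mul, map_sub, LinearMap.sub_apply, sub_eq_zero] at h2
  rw [h1, h2]

variable [CompactSpace K]

/-- Cut `k` into unit-height slices; each takes only the values `0` and `1` where `E` is nonzero. -/
lemma apply_mul_one_eq_of_intCast (hW : ∀ f g, f * g = 0 → W f g = 0)
    {E k : C(K, ℝ)} (hk : 0 ≤ k) (h : ∀ x, E x = 0 ∨ ∃ n : ℤ, k x = n) :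
    W (k * E) 1 = W E k := by
  obtain ⟨N, hN⟩ := exists_nat_ge ‖k‖
  let p (i : ℕ) : C(K, ℝ) := ⟨fun x ↦ unitClamp (k x - i), continuous_unitClamp.comp (by fun_prop)⟩
  have hp : k = ∑ i ∈ Finset.range N, p i := by
    ext x
    rw [ContinuousMap.sum_apply]
    simp only [p, ContinuousMap.coe_mk]
    rw [sum_unitClamp_sub (k x) (hk x), min_eq_left]
    exact ((le_abs_self _).trans (k.norm_coe_le_norm x)).trans hN
  have key (i : ℕ) : W (p i * E) 1 = W E (p i) := by
    refine apply_mul_one_eq_of_mul_mul_one_sub_eq_zero W hW ?_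
    ext x
    simp only [ContinuousMap.mul_apply, ContinuousMap.sub_apply, ContinuousMap.one_apply,
      ContinuousMap.zero_apply, p, ContinuousMap.coe_mk]
    rcases h x with h | ⟨n, h⟩
    · simp [h]
    · rcases unitClamp_intCast_sub_natCast n i with h' | h' <;> simp [h, h']
  rw [hp, Finset.sum_mul, map_sum, map_sum, LinearMap.sum_apply]
  exact Finset.sum_congr rfl fun i _ ↦ key i

/-- The identity is exact for `k`, so only the bounded error `k - t` contributes, at most `2 * M` in
each term. The norm of `t` plays no role. -/
lemma norm_apply_mul_one_sub_le (hW : ∀ f g, f * g = 0 → W f g = 0) {M : ℝ}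
    (hM : ∀ f g, ‖W f g‖ ≤ M * ‖f‖ * ‖g‖) (hM0 : 0 ≤ M)
    {t E k : C(K, ℝ)} (hk : 0 ≤ k) (h : ∀ x, E x = 0 ∨ ∃ n : ℤ, k x = n)
    (hE : ∀ x, |E x| ≤ 1) (hkt : ∀ x, |k x - t x| ≤ 2) :
    ‖W (t * E) 1 - W E t‖ ≤ 4 * M := by
  have hE' : ‖E‖ ≤ 1 := (ContinuousMap.norm_le _ zero_le_one).2 hE
  have hd : ‖k - t‖ ≤ 2 := (ContinuousMap.norm_le _ zero_le_two).2 hkt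
  have h1 : ‖(1 : C(K, ℝ))‖ ≤ 1 := (ContinuousMap.norm_le _ zero_le_one).2 (by simp)
  have heq : W (t * E) 1 - W E t = W E (k - t) - W ((k - t) * E) 1 := by
    rw [sub_mul, map_sub, map_sub, LinearMap.sub_apply, apply_mul_one_eq_of_intCast W hW hk h]
    abel
  have b1 : ‖W E (k - t)‖ ≤ M * 1 * 2 := (hM _ _).trans (by gcongr)
  have b2 : ‖W ((k - t) * E) 1‖ ≤ M * (2 * 1) * 1 :=
    (hM _ _).trans (by gcongr; exact (norm_mul_le _ _).trans (by gcongr))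
  rw [heq]
  exact (norm_sub_le _ _).trans (by linarith)

lemma norm_apply_one_sub_apply_one_le (hW : ∀ f g, f * g = 0 → W f g = 0) {M : ℝ}
    (hM : ∀ f g, ‖W f g‖ ≤ M * ‖f‖ * ‖g‖) (hM0 : 0 ≤ M) {t : C(K, ℝ)} (ht : 0 ≤ t) :
    ‖W t 1 - W 1 t‖ ≤ 8 * M := by
  let E : C(K, ℝ) := ⟨fun x ↦ bump (t x), continuous_bump.comp t.continuous⟩
  let k₀ : C(K, ℝ) := ⟨fun x ↦ ramp (t x), continuous_ramp.comp t.continuous⟩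
  let k₁ : C(K, ℝ) := ⟨fun x ↦ ramp (t x + 1 / 2), continuous_ramp.comp (by fun_prop)⟩
  have h₀ := norm_apply_mul_one_sub_le W hW hM hM0 (t := t) (E := E) (k := k₀)
    (fun x ↦ ramp_nonneg (ht x)) (fun x ↦ bump_eq_zero_or_exists_ramp_eq (t x))
    (fun x ↦ abs_bump_le (t x)) (fun x ↦ (abs_ramp_sub_le (t x)).trans one_le_two)
  have h₁ := norm_apply_mul_one_sub_le W hW hM hM0 (t := t) (E := 1 - E) (k := k₁)
    (fun x ↦ ramp_nonneg (add_nonneg (ht x) (by norm_num)))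
    (fun x ↦ one_sub_bump_eq_zero_or_exists_ramp_eq (t x))
    (fun x ↦ abs_one_sub_bump_le (t x)) (fun x ↦ by
      have := abs_ramp_sub_le (t x + 1 / 2)
      simp only [k₁, ContinuousMap.coe_mk]
      grind)
  have heq : W t 1 - W 1 t =
      (W (t * E) 1 - W E t) + (W (t * (1 - E)) 1 - W (1 - E) t) := by
    rw [mul_sub, mul_one, map_sub, map_sub, LinearMap.sub_apply, LinearMap.sub_apply]
    abel
  rw [heq]
  exact (norm_add_le _ _).trans (by linarith)

/-- A bounded bilinear map on `C(K, ℝ)` which vanishes on pairs of functions with zero product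
is balanced. -/
lemma apply_one_eq_of_forall_mul_eq_zero (hW : ∀ f g, f * g = 0 → W f g = 0) {M : ℝ}
    (hM : ∀ f g, ‖W f g‖ ≤ M * ‖f‖ * ‖g‖) (hM0 : 0 ≤ M) (h : C(K, ℝ)) :
    W h 1 = W 1 h := by
  -- Adding a constant makes `h` nonnegative and leaves the defect unchanged, as `W 1 1` cancels.
  have hpos : 0 ≤ h + ‖h‖ • (1 : C(K, ℝ)) := fun x ↦ by
    have := (abs_le.1 (h.norm_coe_le_norm x)).1
    change 0 ≤ h x + ‖h‖ * 1
    linarith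
  have key (n : ℕ) : n * ‖W h 1 - W 1 h‖ ≤ 8 * M := by
    have := norm_apply_one_sub_apply_one_le W hW hM hM0
      (t := (n : ℝ) • (h + ‖h‖ • (1 : C(K, ℝ)))) (smul_nonneg n.cast_nonneg hpos)
    simpa [← smul_sub, norm_smul] using this
  by_contra hne
  have hlt : 0 < ‖W h 1 - W 1 h‖ := norm_pos_iff.2 (sub_ne_zero.2 hne)
  obtain ⟨n, hn⟩ := exists_nat_gt (8 * M / ‖W h 1 - W 1 h‖)
  rw [div_lt_iff₀ hlt] at hn
  exact absurd (key n) (not_le.2 hn)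

end BilinearContinuousFunctions

section ZeroProductDetermined

variable {A X : Type*} [NonUnitalCStarAlgebra A] [NormedAddCommGroup X] [NormedSpace ℂ X]
  (V : A →ₗ[ℂ] A →ₗ[ℂ] X)

lemma Unitization.inr_snd_of_fst_eq_zero {R S : Type*} [Zero R] {x : Unitization R S}
    (hx : x.fst = 0) : (x.snd : Unitization R S) = x :=
  Unitization.ext hx.symm rfl

lemma apply_mul_eq_of_isSelfAdjoint (hV : ∀ x y, x * y = 0 → V x y = 0) {M : ℝ}
    (hM : ∀ x y, ‖V x y‖ ≤ M * ‖x‖ * ‖y‖) (hM0 : 0 ≤ M) (a c : A) {h : A}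
    (hh : IsSelfAdjoint h) : V (a * h) c = V a (h * c) := by
  -- The unitization gives meaning to `f(h)` for all `f`, including `1`; multiplying by `a` or `c`
  -- returns to the ideal `A`.
  have hu : IsSelfAdjoint (h : Unitization ℂ A) := hh.inr ℂ
  let Φ := cfcHom (R := ℝ) hu
  let L : C(spectrum ℝ (h : Unitization ℂ A), ℝ) →ₗ[ℝ] A :=
    { toFun := fun f ↦ ((a : Unitization ℂ A) * Φ f).snd
      map_add' := fun f g ↦ by rw [map_add, mul_add, Unitization.snd_add]
      map_smul' := fun r f ↦ by
        rw [map_smul, mul_smul_comm, Unitization.snd_smul, RingHom.id_apply] }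
  let R : C(spectrum ℝ (h : Unitization ℂ A), ℝ) →ₗ[ℝ] A :=
    { toFun := fun f ↦ (Φ f * (c : Unitization ℂ A)).snd
      map_add' := fun f g ↦ by rw [map_add, add_mul, Unitization.snd_add]
      map_smul' := fun r f ↦ by
        rw [map_smul, smul_mul_assoc, Unitization.snd_smul, RingHom.id_apply] }
  have hL (f) : (L f : Unitization ℂ A) = (a : Unitization ℂ A) * Φ f :=
    Unitization.inr_snd_of_fst_eq_zero (x := (a : Unitization ℂ A) * Φ f) (by simp)
  have hR (f) : (R f : Unitization ℂ A) = Φ f * (c : Unitization ℂ A) :=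
    Unitization.inr_snd_of_fst_eq_zero (x := Φ f * (c : Unitization ℂ A)) (by simp)
  have hLn (f) : ‖L f‖ ≤ ‖a‖ * ‖f‖ := by
    rw [← Unitization.norm_inr (𝕜 := ℂ), hL]
    refine (norm_mul_le _ _).trans_eq ?_
    rw [Unitization.norm_inr, norm_cfcHom _ _ hu]
  have hRn (f) : ‖R f‖ ≤ ‖c‖ * ‖f‖ := by
    rw [← Unitization.norm_inr (𝕜 := ℂ), hR]
    refine (norm_mul_le _ _).trans_eq ?_
    rw [Unitization.norm_inr, norm_cfcHom _ _ hu, mul_comm]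
  let W : C(spectrum ℝ (h : Unitization ℂ A), ℝ) →ₗ[ℝ]
      C(spectrum ℝ (h : Unitization ℂ A), ℝ) →ₗ[ℝ] X :=
    LinearMap.mk₂ ℝ (fun f g ↦ V (L f) (R g)) (by simp) (by simp) (by simp) (by simp)
  have key := apply_one_eq_of_forall_mul_eq_zero W (M := M * ‖a‖ * ‖c‖) (fun f g hfg ↦ by
      refine hV _ _ (Unitization.inr_injective (R := ℂ) ?_)
      rw [Unitization.inr_mul, hL, hR, mul_assoc, ← mul_assoc (Φ f), ← map_mul, hfg]
      simp) (fun f g ↦ by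
      refine (hM _ _).trans ?_
      calc M * ‖L f‖ * ‖R g‖ ≤ M * (‖a‖ * ‖f‖) * (‖c‖ * ‖g‖) := by
            gcongr
            exacts [hLn f, hRn g]
        _ = _ := by ring) (by positivity)
    ((ContinuousMap.id ℝ).restrict (spectrum ℝ (h : Unitization ℂ A)))
  have hid : Φ ((ContinuousMap.id ℝ).restrict (spectrum ℝ (h : Unitization ℂ A))) = h :=
    cfcHom_id hu
  simpa [W, L, R, hid, ← Unitization.inr_mul] using key

/-- C⋆-algebras are zero product determined: a bounded bilinear map which vanishes on pairs with
zero product is balanced. -/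
theorem apply_mul_eq_apply_mul_of_forall_mul_eq_zero (hV : ∀ x y, x * y = 0 → V x y = 0) {M : ℝ}
    (hM : ∀ x y, ‖V x y‖ ≤ M * ‖x‖ * ‖y‖) (hM0 : 0 ≤ M) (a b c : A) :
    V (a * b) c = V a (b * c) := by
  have h1 := apply_mul_eq_of_isSelfAdjoint V hV hM hM0 a c (realPart b).2
  have h2 := apply_mul_eq_of_isSelfAdjoint V hV hM hM0 a c (imaginaryPart b).2
  conv_lhs => rw [← realPart_add_I_smul_imaginaryPart b]
  conv_rhs => rw [← realPart_add_I_smul_imaginaryPart b]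
  simp only [mul_add, add_mul, mul_smul_comm, smul_mul_assoc, map_add, map_smul,
    LinearMap.add_apply, LinearMap.smul_apply, h1, h2]

end ZeroProductDetermined

lemma exists_isApproximateUnit (A : Type*) [NonUnitalCStarAlgebra A] :
    ∃ l : Filter A, l.IsApproximateUnit := by
  let _ := CStarAlgebra.spectralOrder A
  let _ := CStarAlgebra.spectralOrderedRing A
  exact ⟨_, (CStarAlgebra.increasingApproximateUnit A).toIsApproximateUnit⟩

section Preservers

variable {A B : Type*} [NonUnitalCStarAlgebra A] [NonUnitalCStarAlgebra B]

/-- The bounded linear map `x ↦ φ(x*)*`. -/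
noncomputable def starConj (φ : A →L[ℂ] B) : A →L[ℂ] B where
  toFun x := star (φ (star x))
  map_add' x y := by simp
  map_smul' r x := by simp
  cont := by fun_prop

@[simp] lemma starConj_apply (φ : A →L[ℂ] B) (x : A) : starConj φ x = star (φ (star x)) := rfl

/-- Two bounded linear maps `f`, `g` satisfy `f(ab)g(c) = f(a)g(bc)` if and only if `ab = 0`
implies `f(a)g(b) = 0`. -/
theorem forall_mul_eq_zero_iff_balanced (f g : A →L[ℂ] B) :
    (∀ a b : A, a * b = 0 → f a * g b = 0) ↔
      ∀ a b c : A, f (a * b) * g c = f a * g (b * c) := by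
  constructor
  · intro h
    refine apply_mul_eq_apply_mul_of_forall_mul_eq_zero
      ((LinearMap.mul ℂ B).compl₁₂ (f : A →ₗ[ℂ] B) (g : A →ₗ[ℂ] B)) (M := ‖f‖ * ‖g‖) h
      (fun x y ↦ ?_) (by positivity)
    calc ‖f x * g y‖ ≤ ‖f x‖ * ‖g y‖ := norm_mul_le _ _
      _ ≤ (‖f‖ * ‖x‖) * (‖g‖ * ‖y‖) := by gcongr <;> exact ContinuousLinearMap.le_opNorm _ _
      _ = _ := by ring
  · intro h a b hab
    obtain ⟨l, hl⟩ := exists_isApproximateUnit A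
    have := hl.neBot
    have hlim : Tendsto (fun e ↦ f a * g (b * e)) l (𝓝 (f a * g b)) :=
      ((g.continuous.tendsto b).comp (hl.tendsto_mul_left b)).const_mul (f a)
    refine tendsto_nhds_unique hlim ?_
    simp [← h, hab]

/-- The trilinear version of `forall_mul_eq_zero_iff_balanced`. -/
theorem forall_mul_mul_eq_zero_iff_balanced (f g k : A →L[ℂ] B) :
    (∀ a b c : A, a * b * c = 0 → f a * g b * k c = 0) ↔
      ∀ a b c d e : A, f (a * b) * g c * k (d * e) = f a * g (b * c * d) * k e := by
  constructor
  · intro h a b c d e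
    have bound (x y z : A) : ‖f x * g y * k z‖ ≤ ‖f‖ * ‖x‖ * (‖g‖ * ‖y‖) * (‖k‖ * ‖z‖) :=
      (norm_mul₃_le).trans (by gcongr <;> exact ContinuousLinearMap.le_opNorm _ _)
    -- Freezing one outer variable leaves a bilinear map to which the balancing theorem applies.
    have left (z : A) : f (a * b) * g c * k z = f a * g (b * c) * k z :=
      apply_mul_eq_apply_mul_of_forall_mul_eq_zero
        (((LinearMap.mul ℂ B).compl₁₂ (f : A →ₗ[ℂ] B) (g : A →ₗ[ℂ] B)).compr₂
          (LinearMap.mulRight ℂ (k z))) (M := ‖f‖ * ‖g‖ * (‖k‖ * ‖z‖))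
        (fun x y hxy ↦ h x y z (by rw [hxy, zero_mul]))
        (fun x y ↦ (bound x y z).trans_eq (by ring)) (by positivity) a b c
    have right (y : A) : f a * g (y * d) * k e = f a * g y * k (d * e) :=
      apply_mul_eq_apply_mul_of_forall_mul_eq_zero
        ((LinearMap.mul ℂ B).compl₁₂ ((LinearMap.mulLeft ℂ (f a)).comp (g : A →ₗ[ℂ] B))
          (k : A →ₗ[ℂ] B)) (M := ‖g‖ * ‖k‖ * (‖f‖ * ‖a‖))
        (fun y z hyz ↦ h a y z (by rw [mul_assoc, hyz, mul_zero]))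
        (fun y z ↦ (bound a y z).trans_eq (by ring)) (by positivity) y d e
    rw [left, right]
  · intro h a b c habc
    obtain ⟨l, hl⟩ := exists_isApproximateUnit A
    have := hl.neBot
    -- Balancing turns each term into `f e * g (a * b * c) * k e`, which is zero.
    have hlim : Tendsto (fun e ↦ f (e * a) * g b * k (c * e)) l (𝓝 (f a * g b * k c)) :=
      (((f.continuous.tendsto a).comp (hl.tendsto_mul_right a)).mul_const (g b)).mul
        ((k.continuous.tendsto c).comp (hl.tendsto_mul_left c))
    refine tendsto_nhds_unique hlim ?_
    simp [h, habc]

end Preservers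

theorem theorem2p2 {A B : Type*} [NonUnitalCStarAlgebra A] [NonUnitalCStarAlgebra B]
    (φ : A →L[ℂ] B) :
    (PreservesZeroProducts φ ↔
      ∀ a b c : A, φ (a * b) * φ c = φ a * φ (b * c)) ∧
    (PreservesRangeOrthogonality φ ↔
      ∀ a b c : A, star (φ (star b * a)) * φ c = star (φ a) * φ (b * c)) ∧
    (PreservesDomainOrthogonality φ ↔
      ∀ a b c : A, φ (a * b) * star (φ c) = φ a * star (φ (c * star b))) ∧
    (PreservesZeroTROProducts φ ↔
      ∀ a b c d e : A, φ (a * b) * star (φ c) * φ (d * e) =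
        φ a * star (φ (star d * c * star b)) * φ e) := by
  refine ⟨forall_mul_eq_zero_iff_balanced φ φ, ?_, ?_, ?_⟩
  · have h := forall_mul_eq_zero_iff_balanced (starConj φ) φ
    constructor
    · intro H a b c
      simpa using h.1 (fun a b hab ↦ H (star a) b (by simpa using hab)) (star a) b c
    · intro H a b hab
      simpa using h.2 (fun a b c ↦ by simpa using H (star a) b c) (star a) b hab
  · have h := forall_mul_eq_zero_iff_balanced φ (starConj φ)
    constructor
    · intro H a b c
      simpa using h.1 (fun a b hab ↦ H a (star b) (by simpa using hab)) a b (star c)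
    · intro H a b hab
      simpa using h.2 (fun a b c ↦ by simpa using H a b (star c)) a (star b) hab
  · have h := forall_mul_mul_eq_zero_iff_balanced φ (starConj φ) φ
    constructor
    · intro H a b c d e
      simpa [mul_assoc] using
        h.1 (fun a b c habc ↦ H a (star b) c (by simpa using habc)) a b (star c) d e
    · intro H a b c habc
      simpa using
        h.2 (fun a b c d e ↦ by simpa [mul_assoc] using H a b (star c) d e) a (star b) c habc
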